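/- Fix integers $n,d\ge 0$. Let $\mathbb{R}[\mathbf{x}]$ be the polynomial ring in the variables $x_{ij}=x_{ji}$, one for each two-element subset $\{i,j\}$ of $\{1,\dots,n\}$. The symmetric group $S_n$ acts on it by $\mathfrak{s}\,x_{ij}=x_{\mathfrak{s}(i)\mathfrak{s}(j)}$, and $\operatorname{sym}(f)=\frac1{n!}\sum_{\mathfrak{s}\in S_n}\mathfrak{s}f$. Let $V=\mathbb{R}[\mathbf{x}]_{\le d}$ be the $S_n$-module of polynomials of total degree at most $d$. For a partition $\lambda\vdash n$ let $S^\lambda$ be the real Specht module and let $V_\lambda\subseteq V$ be the $\lambda$-isotypic component, i.e. the sum of all submodules of $V$ isomorphic to $S^\lambda$. A symmetry-adapted basis of $V$ is a basis $(y_{\lambda,i,\tau})$, with $\lambda\vdash n$, $1\le i\le m_\lambda$ and $\tau$ running over the standard tableaux of shape $\lambda$, such that for each $(\lambda,i)$ the elements $y_{\lambda,i,\tau}$ form a basis of a submodule $V_\lambda^i\cong S^\lambda$ and the matrix of each $\mathfrak{s}\in S_n$ on $V_\lambda^i$ in this basis depends only on $\lambda$ and $\mathfrak{s}$, not on $i$.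 Given such a basis and a choice of one standard tableau $\tau_\lambda$ of each shape $\lambda$, let $Y_\lambda$ be the $m_\lambda\times m_\lambda$ matrix with entries $\operatorname{sym}(y_{\lambda,i,\tau_\lambda}\,y_{\lambda,j,\tau_\lambda})$. For a set $\Lambda$ of partitions of $n$ and an ideal $\mathscr{I}\subseteq\mathbb{R}[\mathbf{x}]$, a polynomial $F$ is said to be obtained modulo $\mathscr{I}$ through the Gatermann–Parrilo SDP restricted to $\Lambda$ if there are real positive semidefinite $m_\lambda\times m_\lambda$ matrices $Q_\lambda$ $(\lambda\in\Lambda)$ with $$F\equiv\sum_{\lambda\in\Lambda}\langle Q_\lambda,Y_\lambda\rangle \mod \mathscr{I},\qquad \langle Q,Y\rangle=\sum_{i,j}Q_{ij}Y_{ij}.$$ **Proposition.** Let $\Lambda=\{\lambda_1,\dots,\lambda_k\}$ be a set of partitions of $n$ and let $(f_l)_l$ be a finite family of polynomials in $V_{\lambda_1}\oplus\dots\oplus V_{\lambda_k}$. 1. If $f_l=\sum_{i=1}^k f_{l,i}$ with $f_{l,i}\in V_{\lambda_i}$, then $\operatorname{sym}(f_{l,i}f_{l,j})=0$ for all $i\ne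 j$, and hence $\operatorname{sym}(f_l^2)=\sum_{i=1}^k\operatorname{sym}(f_{l,i}^2)$. 2. Let $\mathscr{I}$ be an ideal modulo which $\sum_l f_l^2$ is $S_n$-invariant, i.e. $\mathfrak{s}\big(\sum_l f_l^2\big)-\sum_l f_l^2\in\mathscr{I}$ for all $\mathfrak{s}\in S_n$. Then for every symmetry-adapted basis of $V$ and every choice of the tableaux $\tau_\lambda$, the sum of squares $\sum_l f_l^2$ is obtained modulo $\mathscr{I}$ through the Gatermann–Parrilo SDP restricted to $\lambda_1,\dots,\lambda_k$. In particular, if $\sum_l f_l^2$ is $S_n$-invariant, this holds with equality of polynomials ($\mathscr{I}=0$). -/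

import Mathlib

noncomputable section

namespace SymSOS

/-! ### The polynomial ring on the edges of `K_n` and the action of the symmetric group -/

/-- The edges of the complete graph on `Fin n`: unordered pairs of distinct vertices. They index the
variables `x_{ij} = x_{ji}`, `i ≠ j`. -/
abbrev Edge (n : ℕ) : Type := {e : Sym2 (Fin n) // ¬ e.IsDiag}

/-- The action of a permutation of the vertices on the edges, `{i, j} ↦ {s i, s j}`. -/
def edgeMap {n : ℕ} (s : Equiv.Perm (Fin n)) (e : Edge n) : Edge n :=
  ⟨Sym2.map s e.1, fun h => e.2 ((Sym2.isDiag_map s.injective).1 h)⟩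

/-- The polynomial ring `ℝ[x]` in the variables `x_{ij}`. -/
abbrev Poly (n : ℕ) : Type := MvPolynomial (Edge n) ℝ

/-- The action of `s` on polynomials, `s x_{ij} = x_{s(i) s(j)}`. -/
def act {n : ℕ} (s : Equiv.Perm (Fin n)) : Poly n →ₐ[ℝ] Poly n :=
  MvPolynomial.rename (edgeMap s)

/-- The space `V = ℝ[x]_{≤ d}` of polynomials of total degree at most `d`. -/
abbrev V (n d : ℕ) : Submodule ℝ (Poly n) := MvPolynomial.restrictTotalDegree (Edge n) ℝ d

theorem act_mem_V {n d : ℕ} (s : Equiv.Perm (Fin n)) : ∀ f ∈ V n d, act s f ∈ V n d := by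
  intro f hf
  rw [MvPolynomial.mem_restrictTotalDegree] at hf ⊢
  exact (MvPolynomial.totalDegree_rename_le _ _).trans hf

theorem act_one {n : ℕ} (f : Poly n) : act 1 f = f := by
  have h : (edgeMap (1 : Equiv.Perm (Fin n))) = id := by
    funext e
    apply Subtype.ext
    simp [edgeMap]
  simp [act, h]

theorem act_mul {n : ℕ} (s t : Equiv.Perm (Fin n)) (f : Poly n) :
    act (s * t) f = act s (act t f) := by
  have h : edgeMap (s * t) = edgeMap s ∘ edgeMap t := by
    funext e
    apply Subtype.ext
    simp [edgeMap, Sym2.map_map]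
  simp only [act, MvPolynomial.rename_rename, h]

/-- `V = ℝ[x]_{≤ d}` as a representation of the symmetric group. -/
def polyRep (n d : ℕ) : Representation ℝ (Equiv.Perm (Fin n)) (V n d) where
  toFun s := (act s).toLinearMap.restrict (act_mem_V s)
  map_one' := by
    ext1 f
    exact Subtype.ext (act_one f.1)
  map_mul' s t := by
    ext1 f
    exact Subtype.ext (act_mul s t f.1)

/-- The symmetrization `sym(f) = (1 / n!) ∑_s s f`. -/
def sym {n : ℕ} (f : Poly n) : Poly n :=
  ((n.factorial : ℝ)⁻¹) • ∑ s : Equiv.Perm (Fin n), act s f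

/-! ### Tableaux and Specht modules -/

/-- The Young diagram of a partition `λ₁ ≥ λ₂ ≥ …` of `n`: cells are pairs (row, column), and
row `i` has `λ_{i+1}` cells. -/
def diagram {n : ℕ} (p : n.Partition) : YoungDiagram :=
  YoungDiagram.ofRowLens (p.parts.sort (· ≥ ·)) (Multiset.pairwise_sort _ _).sortedGE

/-- A tableau of shape `p`: a bijective filling of the cells of the diagram by the elements of
`Fin n`. -/
abbrev Tableau {n : ℕ} (p : n.Partition) : Type := (diagram p).cells ≃ Fin n

/-- The row of the tableau in which an entry stands. -/
def Tableau.row {n : ℕ} {p : n.Partition} (T : Tableau p) (k : Fin n) : ℕ := (T.symm k).1.1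

/-- The column of the tableau in which an entry stands. -/
def Tableau.col {n : ℕ} {p : n.Partition} (T : Tableau p) (k : Fin n) : ℕ := (T.symm k).1.2

/-- A tableau is standard if its entries increase along every row and down every column. -/
def Tableau.IsStandard {n : ℕ} {p : n.Partition} (T : Tableau p) : Prop :=
  (∀ c c' : (diagram p).cells, c.1.1 = c'.1.1 → c.1.2 < c'.1.2 → T c < T c') ∧
  (∀ c c' : (diagram p).cells, c.1.2 = c'.1.2 → c.1.1 < c'.1.1 → T c < T c')

/-- The standard tableaux of shape `p`. -/
abbrev StandardTableau {n : ℕ} (p : n.Partition) : Type := {T : Tableau p // T.IsStandard}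

instance {n : ℕ} (p : n.Partition) : Fintype (StandardTableau p) := Fintype.ofFinite _

/-- The permutation module on row assignments: formal real linear combinations of functions
`Fin n → ℕ`. A tabloid (a tableau up to permuting entries within rows) is the same thing as the
function assigning to each entry its row, so this module contains the permutation module on the
tabloids of any shape. -/
def TabloidModule (n : ℕ) : Type := (Fin n → ℕ) →₀ ℝ

instance (n : ℕ) : AddCommGroup (TabloidModule n) :=
  inferInstanceAs (AddCommGroup ((Fin n → ℕ) →₀ ℝ))

instance (n : ℕ) : Module ℝ (TabloidModule n) :=
  inferInstanceAs (Module ℝ ((Fin n → ℕ) →₀ ℝ))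

/-- The basis vector of a row assignment. -/
def rowVec {n : ℕ} (r : Fin n → ℕ) : TabloidModule n :=
  (Finsupp.single r (1 : ℝ) : (Fin n → ℕ) →₀ ℝ)

/-- A permutation `s` moves the entry `k` to `s k`, so it sends the row assignment `r` to
`r ∘ s⁻¹`. -/
def tabloidRep (n : ℕ) : Representation ℝ (Equiv.Perm (Fin n)) (TabloidModule n) where
  toFun s := (Finsupp.lmapDomain ℝ ℝ (fun r : Fin n → ℕ => r ∘ ⇑s⁻¹) :
    ((Fin n → ℕ) →₀ ℝ) →ₗ[ℝ] ((Fin n → ℕ) →₀ ℝ))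
  map_one' := LinearMap.ext fun x => Finsupp.mapDomain_id (v := x)
  map_mul' s t := LinearMap.ext fun x => Finsupp.mapDomain_comp (v := x)
    (f := fun r : Fin n → ℕ => r ∘ ⇑t⁻¹) (g := fun r : Fin n → ℕ => r ∘ ⇑s⁻¹)

theorem tabloidRep_rowVec {n : ℕ} (s : Equiv.Perm (Fin n)) (r : Fin n → ℕ) :
    tabloidRep n s (rowVec r) = rowVec (r ∘ ⇑s⁻¹) :=
  Finsupp.mapDomain_single

/-- The polytabloid `e_T = ∑_{s ∈ C_T} sgn(s) s{T}`, where `C_T` is the column group of `T` and `{T}`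
is its tabloid. -/
def polytabloid {n : ℕ} {p : n.Partition} (T : Tableau p) : TabloidModule n :=
  ∑ s : Equiv.Perm (Fin n) with (∀ k, T.col (s k) = T.col k),
    ((Equiv.Perm.sign s : ℤ) : ℝ) • tabloidRep n s (rowVec T.row)

/-- The Specht module of `p` over `ℝ`: the submodule generated by the polytabloids of shape `p`. -/
def specht {n : ℕ} (p : n.Partition) :
    Submodule (MonoidAlgebra ℝ (Equiv.Perm (Fin n))) (tabloidRep n).asModule :=
  Submodule.span (MonoidAlgebra ℝ (Equiv.Perm (Fin n)))
    (Set.range fun T : Tableau p => (tabloidRep n).asModuleEquiv.symm (polytabloid T))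

/-- The isotypic `V_p` of `V = ℝ[x]_{≤ d}`: the sum of all submodules isomorphic to the Specht
module of `p`. -/
def isotypic (n d : ℕ) (p : n.Partition) : Submodule ℝ (V n d) :=
  ((isotypicComponent (MonoidAlgebra ℝ (Equiv.Perm (Fin n))) (polyRep n d).asModule (specht p)).restrictScalars
    ℝ).map (polyRep n d).asModuleEquiv.toLinearMap

/-! ### Symmetry-adapted bases and the restricted semidefinite program -/

/-- A symmetry-adapted basis of `V = ℝ[x]_{≤ d}`. It is the concatenation of bases
`y_{p,i,t}` (`t` a standard tableau of shape `p`) of the irreducible summands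
`V_p^i`, `i = 1, …, m_p`, of a decomposition `V = ⨁_p ⨁_i V_p^i` with `V_p^i` isomorphic to the
Specht module of `p`, such that the matrix by which `s` acts on `V_p^i` in the given basis
depends on `p` and `s` only, and not on `i`. -/
structure SymmetryAdaptedBasis (n d : ℕ) where
  /-- the multiplicities `m_p` -/
  mult : n.Partition → ℕ
  /-- the basis polynomials `y_{p,i,t}` -/
  basis : Module.Basis (Σ p : n.Partition, Fin (mult p) × StandardTableau p) ℝ (V n d)
  /-- the representing matrices shared by `V_p^1, …, V_p^{m_p}` -/
  block : ∀ p : n.Partition, Equiv.Perm (Fin n) →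
    Matrix (StandardTableau p) (StandardTableau p) ℝ
  /-- `s` acts on the basis of `V_p^i` by the matrix `block p s` -/
  polyRep_basis : ∀ (s : Equiv.Perm (Fin n)) (p : n.Partition) (i : Fin (mult p))
    (t : StandardTableau p),
    polyRep n d s (basis ⟨p, i, t⟩) = ∑ t', block p s t' t • basis ⟨p, i, t'⟩
  /-- `V_p^i` is isomorphic to the Specht module of `p` -/
  iso_specht : ∀ (p : n.Partition) (i : Fin (mult p)),
    Nonempty (Submodule.span (MonoidAlgebra ℝ (Equiv.Perm (Fin n)))
      (Set.range fun t => (polyRep n d).asModuleEquiv.symm (basis ⟨p, i, t⟩))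
        ≃ₗ[MonoidAlgebra ℝ (Equiv.Perm (Fin n))] specht p)

/-- The `m_p × m_p` matrix of polynomials `Y_p = sym(y_t y_tᵀ)`, where
`y_t = (y_{p,1,t}, …, y_{p,m_p,t})` for a chosen standard tableau `t` of shape `p`. -/
def SymmetryAdaptedBasis.Y {n d : ℕ} (B : SymmetryAdaptedBasis n d) (p : n.Partition)
    (t : StandardTableau p) : Matrix (Fin (B.mult p)) (Fin (B.mult p)) (Poly n) :=
  Matrix.of fun i j => sym ((B.basis ⟨p, i, t⟩ : Poly n) * (B.basis ⟨p, j, t⟩ : Poly n))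

/-- `F` can be obtained, modulo the ideal `I`, through the symmetry-adapted semidefinite program
restricted to the partitions in `Λ`: there are positive semidefinite real matrices `Q_p`, `p ∈ Λ`,
with `F ≡ ∑_{p ∈ Λ} ⟨Q_p, Y_p⟩` modulo `I`. The matrices `Y_p` are formed from the symmetry-adapted
basis `B` and the standard tableaux `t p`. -/
def ObtainableThroughGP {n d : ℕ} (B : SymmetryAdaptedBasis n d)
    (t : ∀ p : n.Partition, StandardTableau p) (I : Ideal (Poly n)) (Λ : Finset n.Partition)
    (F : Poly n) : Prop :=
  ∃ Q : ∀ p : n.Partition, Matrix (Fin (B.mult p)) (Fin (B.mult p)) ℝ,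
    (∀ p ∈ Λ, (Q p).PosSemidef) ∧
    F - ∑ p ∈ Λ, ∑ i, ∑ j, Q p i j • B.Y p (t p) i j ∈ I

end SymSOS

end

/-!
The proof rests on one fact about Specht modules: a bilinear map `β` on `S^p × S^q`, with values in
a real vector space and invariant under the symmetric group, vanishes for `p ≠ q`, and for `p = q`
it is the standard inner product `⟨u, v⟩` times a constant vector
(`IsInvariantForm.eq_zero_of_ne`, `IsInvariantForm.exists_eq_spechtInner_smul`). This combines
Schur's lemma, absolute irreducibility and self-duality of the Specht modules, and it is proved
directly by James' method. With `κ_T` the column antisymmetrizer and `e_T = κ_T {T}`, the element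
`κ_T` is self-adjoint for `β`, so `|C_T| β(e_T, v) = β(κ_T e_T, v) = β(e_T, κ_T v)`. Now `κ_T {U}`
is zero unless the entries in each column of `T` lie in distinct rows of `U`. That forces the shape
of `T` to dominate the shape of `U` (`InjOnColumns.cellsAbove_le`), and for equal shapes it makes
`{U}` a translate of `{T}` under the column group (`InjOnColumns.exists_perm`), so that `κ_T v` is a
multiple of `e_T`. If `β ≠ 0`, applying the first conclusion to `β` and to its flip gives `p = q`; if
`p = q`, both `β` and `⟨·, ·⟩` are determined by their common value on the pairs `(e_T, e_T)`.

The form `(f, g) ↦ sym(f g)` on `V` is invariant with values in the polynomials, so distinct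
isotypic components are orthogonal for it, which is the vanishing of the cross terms. Moreover
`sym(g²) = 0` only for `g = 0`, since the polynomials are real; hence the components of `f_l` in a
symmetry-adapted basis belonging to shapes outside `Λ` vanish. Because the summands `V_p^i` share
their representing matrices, there are vectors `ε_t ∈ S^p` and equivariant maps `φ_i` with
`y_{p,i,t} = φ_i(ε_t)` for all `i` and `t`. The form `sym(φ_i(u) φ_j(v))` is then `⟨u, v⟩ c_{ij}`, and
if the component of `f_l` is `∑_i φ_i(a_{l,i})`, then `∑_l sym(f_{l,p}²) = ⟨Q, Y_p⟩` for
`Q_{ij} = ∑_l ⟨a_{l,i}, a_{l,j}⟩ / ⟨ε_t, ε_t⟩`, a positive multiple of a sum of Gram matrices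
(`SymmetryAdaptedBasis.exists_posSemidef`). Finally, a polynomial that is invariant modulo an ideal
is congruent to its symmetrization.
-/

noncomputable section

namespace SymSOS

open Finset

/-! ### Dominance of row assignments injective on columns -/

theorem diagram_injective {n : ℕ} : Function.Injective (diagram (n := n)) := by
  intro p q h
  have rowLens_diagram : ∀ p : n.Partition, (diagram p).rowLens = p.parts.sort (· ≥ ·) := fun p =>
    YoungDiagram.rowLens_ofRowLens_eq_self fun x hx => p.parts_pos ((Multiset.mem_sort _).1 hx)
  apply Nat.Partition.ext
  rw [← Multiset.sort_eq p.parts (· ≥ ·), ← Multiset.sort_eq q.parts (· ≥ ·), ← rowLens_diagram,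
    ← rowLens_diagram, h]

/-- The number of cells in the first `m` rows of the diagram of `p`, i.e. the partial sum
`p₁ + ⋯ + p_m`. -/
def cellsAbove {n : ℕ} (p : n.Partition) (m : ℕ) : ℕ :=
  #{c ∈ (diagram p).cells | c.1 < m}

theorem card_filter_tableau {n : ℕ} {p : n.Partition} (T : Tableau p) (P : ℕ × ℕ → Prop)
    [DecidablePred P] :
    #{k : Fin n | P (T.row k, T.col k)} = #{c ∈ (diagram p).cells | P c} := by
  refine Finset.card_bij (fun k _ => (T.symm k).1) ?_ ?_ ?_
  · intro k hk
    exact mem_filter.2 ⟨(T.symm k).2, (mem_filter.1 hk).2⟩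
  · intro k _ k' _ h
    exact T.symm.injective (Subtype.ext h)
  · intro c hc
    obtain ⟨hc, hP⟩ := mem_filter.1 hc
    exact ⟨T ⟨c, hc⟩, mem_filter.2 ⟨mem_univ _, by simpa [Tableau.row, Tableau.col] using hP⟩,
      by simp⟩

theorem card_row_lt {n : ℕ} {p : n.Partition} (T : Tableau p) (m : ℕ) :
    #{k : Fin n | T.row k < m} = cellsAbove p m :=
  card_filter_tableau T (fun c => c.1 < m)

theorem card_col_eq_row_lt {n : ℕ} {p : n.Partition} (T : Tableau p) (c m : ℕ) :
    #{k : Fin n | T.col k = c ∧ T.row k < m} = min ((diagram p).colLen c) m := by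
  rw [card_filter_tableau T (fun x => x.2 = c ∧ x.1 < m), ← card_range (min _ m),
    ← Finset.card_image_of_injective (range _) (f := fun i => (i, c))
      (fun i j h => (Prod.ext_iff.1 h).1)]
  congr 1
  ext ⟨i, j⟩
  simp only [mem_filter, YoungDiagram.mem_cells, mem_image, mem_range, lt_min_iff, Prod.mk.injEq]
  constructor
  · rintro ⟨h, rfl, hm⟩
    exact ⟨i, ⟨YoungDiagram.mem_iff_lt_colLen.1 h, hm⟩, rfl, rfl⟩
  · rintro ⟨i', ⟨h, hm⟩, rfl, rfl⟩
    exact ⟨YoungDiagram.mem_iff_lt_colLen.2 h, rfl, hm⟩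

theorem card_col_eq {n : ℕ} {p : n.Partition} (T : Tableau p) (c : ℕ) :
    #{k : Fin n | T.col k = c} = (diagram p).colLen c := by
  rw [← min_self ((diagram p).colLen c), ← card_col_eq_row_lt T]
  congr 1
  ext k
  simp only [mem_filter, mem_univ, true_and, iff_self_and]
  rintro rfl
  exact YoungDiagram.mem_iff_lt_colLen.1 (T.symm k).2

/-- The numbers of cells in the first rows determine the partition. -/
theorem cellsAbove_injective {n : ℕ} {p q : n.Partition} (h : cellsAbove p = cellsAbove q) :
    p = q := by
  have rowLen_add : ∀ (p : n.Partition) (i : ℕ),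
      cellsAbove p (i + 1) = cellsAbove p i + (diagram p).rowLen i := by
    intro p i
    rw [YoungDiagram.rowLen_eq_card, YoungDiagram.row, cellsAbove, cellsAbove,
      ← card_union_of_disjoint, ← filter_or]
    · congr 1
      ext c
      simp only [mem_filter, Nat.lt_succ_iff_lt_or_eq, and_or_left]
    · rw [disjoint_filter]
      intro c _ h h'
      omega
  apply diagram_injective
  ext ⟨i, j⟩
  have hi : (diagram p).rowLen i = (diagram q).rowLen i := by
    have h1 := rowLen_add p i
    have h2 := rowLen_add q i
    rw [h] at h1
    omega
  simp only [YoungDiagram.mem_cells, YoungDiagram.mem_iff_lt_rowLen, hi]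

/-- `r` takes distinct values on distinct entries of each column of `T`. -/
def InjOnColumns {n : ℕ} {p : n.Partition} (T : Tableau p) (r : Fin n → ℕ) : Prop :=
  ∀ a b, T.col a = T.col b → r a = r b → a = b

theorem InjOnColumns.card_le {n : ℕ} {p : n.Partition} {T : Tableau p} {r : Fin n → ℕ}
    (h : InjOnColumns T r) (c m : ℕ) :
    #{k : Fin n | T.col k = c ∧ r k < m} ≤ min ((diagram p).colLen c) m := by
  refine le_min ?_ ?_
  · rw [← card_col_eq T]
    exact card_le_card fun k hk => by simp_all
  · rw [← card_range m]
    refine card_le_card_of_injOn r (fun k hk => by simp_all) ?_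
    intro a ha b hb hab
    simp only [coe_filter, mem_univ, true_and, Set.mem_ofPred_eq] at ha hb
    exact h a b (ha.1.trans hb.1.symm) hab

theorem card_eq_sum_columns {n : ℕ} {p : n.Partition} (T : Tableau p) (P : Fin n → Prop)
    [DecidablePred P] :
    #{k : Fin n | P k} =
      ∑ c ∈ univ.image T.col, #{k : Fin n | T.col k = c ∧ P k} := by
  rw [card_eq_sum_card_fiberwise (f := T.col) (t := univ.image T.col)
    (fun k _ => mem_coe.2 (mem_image_of_mem _ (mem_univ k)))]
  refine sum_congr rfl fun c _ => ?_
  rw [filter_filter]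
  simp only [and_comm]

/-- If the rows of a tableau `U` of shape `q` are injective on the columns of a tableau of shape
`p`, then `p` dominates `q`. -/
theorem InjOnColumns.cellsAbove_le {n : ℕ} {p q : n.Partition} {T : Tableau p} {U : Tableau q}
    (h : InjOnColumns T U.row) (m : ℕ) : cellsAbove q m ≤ cellsAbove p m := by
  rw [← card_row_lt U, ← card_row_lt T, card_eq_sum_columns T, card_eq_sum_columns T]
  refine sum_le_sum fun c _ => ?_
  rw [card_col_eq_row_lt]
  exact h.card_le c m

/-- For equal shapes, the entries of a column of `T` of length `c` lie in the first `c` rows of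
`U`. -/
theorem InjOnColumns.row_lt_colLen {n : ℕ} {p : n.Partition} {T U : Tableau p}
    (h : InjOnColumns T U.row) (k : Fin n) : U.row k < (diagram p).colLen (T.col k) := by
  -- Both sides of the column-wise bound `card_le` have the same sum, so it is an equality.
  have key : ∀ m, ∀ c ∈ univ.image T.col,
      #{k : Fin n | T.col k = c ∧ U.row k < m} = #{k : Fin n | T.col k = c ∧ T.row k < m} := by
    intro m
    refine (sum_eq_sum_iff_of_le fun c _ => ?_).1 ?_
    · rw [card_col_eq_row_lt]
      exact h.card_le c m
    · rw [← card_eq_sum_columns T (fun k => U.row k < m),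
        ← card_eq_sum_columns T (fun k => T.row k < m), card_row_lt, card_row_lt]
  have hk := key ((diagram p).colLen (T.col k)) (T.col k) (mem_image_of_mem _ (mem_univ k))
  rw [card_col_eq_row_lt, min_self, ← card_col_eq T] at hk
  have hsub := Finset.ext_iff.1
    (eq_of_subset_of_card_le (fun x hx => by simp_all only [mem_filter, true_and]) hk.ge) k
  rw [mem_filter, mem_filter, card_col_eq T] at hsub
  exact (hsub.2 ⟨mem_univ _, rfl⟩).2.2

/-- For tableaux of the same shape, the column group of `T` carries the tabloid of `U` to that
of `T`. -/
theorem InjOnColumns.exists_perm {n : ℕ} {p : n.Partition} {T U : Tableau p}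
    (h : InjOnColumns T U.row) :
    ∃ s : Equiv.Perm (Fin n), (∀ k, T.col (s k) = T.col k) ∧ U.row = T.row ∘ s := by
  let s : Fin n → Fin n := fun k =>
    T ⟨(U.row k, T.col k), YoungDiagram.mem_iff_lt_colLen.2 (h.row_lt_colLen k)⟩
  have hcol : ∀ k, T.col (s k) = T.col k := fun k => by simp [s, Tableau.col]
  have hrow : ∀ k, T.row (s k) = U.row k := fun k => by simp [s, Tableau.row]
  have hs : Function.Injective s := fun a b hab =>
    h a b (by rw [← hcol a, ← hcol b, hab]) (by rw [← hrow a, ← hrow b, hab])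
  exact ⟨Equiv.ofBijective s (Finite.injective_iff_bijective.1 hs), hcol,
    funext fun k => (hrow k).symm⟩

/-! ### Column antisymmetrizers -/

/-- The real group ring of the symmetric group. -/
abbrev GroupRing (n : ℕ) : Type := MonoidAlgebra ℝ (Equiv.Perm (Fin n))

/-- A permutation as an element of the group ring. -/
abbrev perm {n : ℕ} (s : Equiv.Perm (Fin n)) : GroupRing n :=
  MonoidAlgebra.of ℝ (Equiv.Perm (Fin n)) s

/-- The tabloid of a row assignment, as an element of the module over the group ring. -/
def tabloid {n : ℕ} (r : Fin n → ℕ) : (tabloidRep n).asModule :=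
  (tabloidRep n).asModuleEquiv.symm (rowVec r)

/-- The column group `C_T` of a tableau. -/
def columnGroup {n : ℕ} {p : n.Partition} (T : Tableau p) : Finset (Equiv.Perm (Fin n)) :=
  {s | ∀ k, T.col (s k) = T.col k}

/-- The column antisymmetrizer `κ_T = ∑_{s ∈ C_T} sgn(s) s` of a tableau. -/
def columnAntisymmetrizer {n : ℕ} {p : n.Partition} (T : Tableau p) : GroupRing n :=
  ∑ s ∈ columnGroup T, ((Equiv.Perm.sign s : ℤ) : ℝ) • perm s

theorem mem_columnGroup {n : ℕ} {p : n.Partition} {T : Tableau p} {s : Equiv.Perm (Fin n)} :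
    s ∈ columnGroup T ↔ ∀ k, T.col (s k) = T.col k := by
  simp [columnGroup]

theorem one_mem_columnGroup {n : ℕ} {p : n.Partition} (T : Tableau p) : 1 ∈ columnGroup T :=
  mem_columnGroup.2 fun _ => rfl

theorem mul_mem_columnGroup {n : ℕ} {p : n.Partition} {T : Tableau p}
    {s t : Equiv.Perm (Fin n)} (hs : s ∈ columnGroup T) (ht : t ∈ columnGroup T) :
    s * t ∈ columnGroup T :=
  mem_columnGroup.2 fun k => (mem_columnGroup.1 hs (t k)).trans (mem_columnGroup.1 ht k)

theorem inv_mem_columnGroup {n : ℕ} {p : n.Partition} {T : Tableau p}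
    {s : Equiv.Perm (Fin n)} (hs : s ∈ columnGroup T) : s⁻¹ ∈ columnGroup T :=
  mem_columnGroup.2 fun k => by
    have h := mem_columnGroup.1 hs (s⁻¹ k)
    rw [show s (s⁻¹ k) = k from s.apply_symm_apply k] at h
    exact h.symm

theorem sign_mul_self {n : ℕ} (s : Equiv.Perm (Fin n)) :
    ((Equiv.Perm.sign s : ℤ) : ℝ) * ((Equiv.Perm.sign s : ℤ) : ℝ) = 1 := by
  rcases Int.units_eq_one_or (Equiv.Perm.sign s) with h | h <;> simp [h]

theorem columnAntisymmetrizer_mul_perm {n : ℕ} {p : n.Partition} {T : Tableau p}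
    {s : Equiv.Perm (Fin n)} (hs : s ∈ columnGroup T) :
    columnAntisymmetrizer T * perm s =
      ((Equiv.Perm.sign s : ℤ) : ℝ) • columnAntisymmetrizer T := by
  rw [columnAntisymmetrizer, Finset.sum_mul, Finset.smul_sum]
  refine Finset.sum_bij (fun t _ => t * s) (fun t ht => mul_mem_columnGroup ht hs)
    (fun a _ b _ h => mul_right_cancel h)
    (fun t ht => ⟨t * s⁻¹, mul_mem_columnGroup ht (inv_mem_columnGroup hs), by simp⟩) ?_
  intro t _
  rw [smul_mul_assoc, ← map_mul, smul_smul, Equiv.Perm.sign_mul, Units.val_mul, Int.cast_mul,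
    mul_left_comm, sign_mul_self, mul_one]

theorem columnAntisymmetrizer_mul_self {n : ℕ} {p : n.Partition} (T : Tableau p) :
    columnAntisymmetrizer T * columnAntisymmetrizer T =
      (#(columnGroup T) : ℝ) • columnAntisymmetrizer T := by
  conv_lhs => enter [2]; rw [columnAntisymmetrizer]
  rw [Finset.mul_sum, Finset.sum_congr rfl fun s hs => by
    rw [mul_smul_comm, columnAntisymmetrizer_mul_perm hs, smul_smul, sign_mul_self, one_smul]]
  rw [Finset.sum_const, Nat.cast_smul_eq_nsmul]

/-- `s κ_T = κ_{sT} s`, where `sT` is the tableau `T.trans s`. -/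
theorem perm_mul_columnAntisymmetrizer {n : ℕ} {p : n.Partition} (T : Tableau p)
    (s : Equiv.Perm (Fin n)) :
    perm s * columnAntisymmetrizer T = columnAntisymmetrizer (T.trans s) * perm s := by
  have hcol : ∀ k, Tableau.col (T.trans s) k = T.col (s⁻¹ k) := fun k => rfl
  have hinv : ∀ k, s⁻¹ (s k) = k := s.symm_apply_apply
  rw [columnAntisymmetrizer, columnAntisymmetrizer, Finset.mul_sum, Finset.sum_mul]
  refine Finset.sum_bij (fun t _ => s * t * s⁻¹) ?_ (fun a _ b _ h => by simpa using h) ?_ ?_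
  · intro t ht
    rw [mem_columnGroup] at ht ⊢
    intro k
    simp only [hcol, Equiv.Perm.mul_apply, hinv, ht]
  · intro t ht
    refine ⟨s⁻¹ * t * s, ?_, by group⟩
    rw [mem_columnGroup] at ht ⊢
    intro k
    have h := ht (s k)
    simpa only [hcol, hinv, Equiv.Perm.mul_apply] using h
  · intro t _
    rw [mul_smul_comm, smul_mul_assoc, ← map_mul, ← map_mul, inv_mul_cancel_right,
      Equiv.Perm.sign_mul, Equiv.Perm.sign_mul, Equiv.Perm.sign_inv, mul_right_comm,
      Int.units_mul_self, one_mul]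

/-! ### Polytabloids -/

theorem perm_smul_tabloid {n : ℕ} (s : Equiv.Perm (Fin n)) (r : Fin n → ℕ) :
    perm s • tabloid r = tabloid (r ∘ ⇑s⁻¹) := by
  rw [tabloid, ← Representation.asModuleEquiv_symm_map_rho, tabloidRep_rowVec, tabloid]

theorem columnAntisymmetrizer_smul_tabloid_row {n : ℕ} {p : n.Partition} (T : Tableau p) :
    columnAntisymmetrizer T • tabloid T.row =
      (tabloidRep n).asModuleEquiv.symm (polytabloid T) := by
  rw [columnAntisymmetrizer, polytabloid, Finset.sum_smul, map_sum]
  refine Finset.sum_congr rfl fun s _ => ?_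
  rw [map_smul, Representation.asModuleEquiv_symm_map_rho, smul_assoc, tabloid]

/-- `κ_T` kills each tabloid that has two entries of some column of `T` in the same row. -/
theorem columnAntisymmetrizer_smul_tabloid_eq_zero {n : ℕ} {p : n.Partition} (T : Tableau p)
    (r : Fin n → ℕ) (h : ¬ InjOnColumns T r) : columnAntisymmetrizer T • tabloid r = 0 := by
  simp only [InjOnColumns, not_forall] at h
  obtain ⟨a, b, hcol, hr, hab⟩ := h
  -- The transposition `(a b)` fixes the tabloid and changes the sign of `κ_T`.
  have hmem : Equiv.swap a b ∈ columnGroup T := mem_columnGroup.2 fun k => by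
    by_cases ha : k = a
    · subst ha; simp [hcol]
    by_cases hb : k = b
    · subst hb; simp [hcol]
    rw [Equiv.swap_apply_of_ne_of_ne ha hb]
  have hfix : perm (Equiv.swap a b) • tabloid r = tabloid r := by
    rw [perm_smul_tabloid, Equiv.swap_inv]
    congr 1
    funext k
    by_cases ha : k = a
    · subst ha; simp [hr]
    by_cases hb : k = b
    · subst hb; simp [hr]
    rw [Function.comp_apply, Equiv.swap_apply_of_ne_of_ne ha hb]
  have hneg : columnAntisymmetrizer T • tabloid r = -(columnAntisymmetrizer T • tabloid r) := by
    conv_lhs => rw [← hfix, ← mul_smul, columnAntisymmetrizer_mul_perm hmem,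
      Equiv.Perm.sign_swap hab]
    simp
  have h2 : (2 : ℝ) • (columnAntisymmetrizer T • tabloid r) = 0 := by
    rw [two_smul]
    nth_rewrite 1 [hneg]
    exact neg_add_cancel _
  exact (smul_eq_zero.1 h2).resolve_left two_ne_zero

/-- James' lemma for tableaux of equal shape: `κ_T` maps each tabloid to a multiple of the
polytabloid of `T`. -/
theorem exists_columnAntisymmetrizer_smul_tabloid {n : ℕ} {p : n.Partition} (T U : Tableau p) :
    ∃ c : ℝ, columnAntisymmetrizer T • tabloid U.row =
      c • (tabloidRep n).asModuleEquiv.symm (polytabloid T) := by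
  by_cases h : InjOnColumns T U.row
  · obtain ⟨s, hs, hrow⟩ := h.exists_perm
    refine ⟨((Equiv.Perm.sign s⁻¹ : ℤ) : ℝ), ?_⟩
    have htab : tabloid U.row = perm s⁻¹ • tabloid T.row := by
      rw [perm_smul_tabloid, inv_inv, hrow]
    rw [htab, ← mul_smul,
      columnAntisymmetrizer_mul_perm (inv_mem_columnGroup (mem_columnGroup.2 hs)), smul_assoc,
      columnAntisymmetrizer_smul_tabloid_row]
  · exact ⟨0, by rw [columnAntisymmetrizer_smul_tabloid_eq_zero T _ h, zero_smul]⟩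

/-- The real span of the tabloids of shape `p`. -/
def tabloidSpan {n : ℕ} (p : n.Partition) : Submodule ℝ (tabloidRep n).asModule :=
  Submodule.span ℝ (Set.range fun U : Tableau p => tabloid U.row)

theorem smul_mem_tabloidSpan {n : ℕ} {p : n.Partition} (a : GroupRing n)
    {x : (tabloidRep n).asModule} (hx : x ∈ tabloidSpan p) : a • x ∈ tabloidSpan p := by
  induction a using MonoidAlgebra.induction_on with
  | of s =>
    induction hx using Submodule.span_induction with
    | mem x hx =>
      obtain ⟨U, rfl⟩ := hx
      refine Submodule.subset_span ⟨U.trans s, ?_⟩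
      exact (perm_smul_tabloid s U.row).symm
    | zero => rw [smul_zero]; exact zero_mem _
    | add x y _ _ hx hy => rw [smul_add]; exact add_mem hx hy
    | smul c x _ hx => rw [smul_comm]; exact Submodule.smul_mem _ c hx
  | add a b ha hb => rw [add_smul]; exact add_mem ha hb
  | smul c a ha => rw [smul_assoc]; exact Submodule.smul_mem _ c ha

theorem mem_tabloidSpan_of_mem_specht {n : ℕ} {p : n.Partition} {x : (tabloidRep n).asModule}
    (hx : x ∈ specht p) : x ∈ tabloidSpan p := by
  induction hx using Submodule.span_induction with
  | mem x hx =>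
    obtain ⟨T, rfl⟩ := hx
    beta_reduce
    rw [← columnAntisymmetrizer_smul_tabloid_row]
    exact smul_mem_tabloidSpan _ (Submodule.subset_span ⟨T, rfl⟩)
  | zero => exact zero_mem _
  | add x y _ _ hx hy => exact add_mem hx hy
  | smul a x _ hx => exact smul_mem_tabloidSpan a hx

/-- The polytabloid of `T` as an element of the Specht module. -/
def spechtVec {n : ℕ} {p : n.Partition} (T : Tableau p) : specht p :=
  ⟨(tabloidRep n).asModuleEquiv.symm (polytabloid T), Submodule.subset_span ⟨T, rfl⟩⟩

theorem perm_smul_spechtVec {n : ℕ} {p : n.Partition} (T : Tableau p) (s : Equiv.Perm (Fin n)) :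
    perm s • spechtVec T = spechtVec (T.trans s) := by
  apply Subtype.ext
  change perm s • (tabloidRep n).asModuleEquiv.symm (polytabloid T) =
    (tabloidRep n).asModuleEquiv.symm (polytabloid (T.trans s))
  rw [← columnAntisymmetrizer_smul_tabloid_row, ← columnAntisymmetrizer_smul_tabloid_row,
    ← mul_smul, perm_mul_columnAntisymmetrizer, mul_smul, perm_smul_tabloid]
  rfl

theorem columnAntisymmetrizer_smul_spechtVec {n : ℕ} {p : n.Partition} (T : Tableau p) :
    columnAntisymmetrizer T • spechtVec T = (#(columnGroup T) : ℝ) • spechtVec T := by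
  apply Subtype.ext
  change columnAntisymmetrizer T • (tabloidRep n).asModuleEquiv.symm (polytabloid T) =
    (#(columnGroup T) : ℝ) • (tabloidRep n).asModuleEquiv.symm (polytabloid T)
  rw [← columnAntisymmetrizer_smul_tabloid_row, ← mul_smul, columnAntisymmetrizer_mul_self,
    smul_assoc]

theorem columnAntisymmetrizer_smul_eq_zero {n : ℕ} {p q : n.Partition} (T : Tableau p)
    (h : ∀ U : Tableau q, ¬ InjOnColumns T U.row) (v : specht q) :
    columnAntisymmetrizer T • v = 0 := by
  apply Subtype.ext
  change columnAntisymmetrizer T • (v : (tabloidRep n).asModule) = 0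
  have hv := mem_tabloidSpan_of_mem_specht v.2
  generalize (v : (tabloidRep n).asModule) = x at hv
  induction hv using Submodule.span_induction with
  | mem x hx =>
    obtain ⟨U, rfl⟩ := hx
    exact columnAntisymmetrizer_smul_tabloid_eq_zero T _ (h U)
  | zero => rw [smul_zero]
  | add x y _ _ hx hy => rw [smul_add, hx, hy, add_zero]
  | smul c x _ hx => rw [smul_comm, hx, smul_zero]

theorem exists_columnAntisymmetrizer_smul_eq {n : ℕ} {p : n.Partition} (T : Tableau p)
    (v : specht p) : ∃ c : ℝ, columnAntisymmetrizer T • v = c • spechtVec T := by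
  suffices h : ∃ c : ℝ, columnAntisymmetrizer T • (v : (tabloidRep n).asModule) =
      c • (tabloidRep n).asModuleEquiv.symm (polytabloid T) from
    h.imp fun c hc => Subtype.ext hc
  have hv := mem_tabloidSpan_of_mem_specht v.2
  generalize (v : (tabloidRep n).asModule) = x at hv
  induction hv using Submodule.span_induction with
  | mem x hx =>
    obtain ⟨U, rfl⟩ := hx
    exact exists_columnAntisymmetrizer_smul_tabloid T U
  | zero => exact ⟨0, by rw [smul_zero, zero_smul]⟩
  | add x y _ _ hx hy =>
    obtain ⟨a, ha⟩ := hx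
    obtain ⟨b, hb⟩ := hy
    exact ⟨a + b, by rw [smul_add, ha, hb, add_smul]⟩
  | smul c x _ hx =>
    obtain ⟨a, ha⟩ := hx
    exact ⟨c * a, by rw [smul_comm, ha, mul_smul]⟩

/-! ### Invariant bilinear forms on Specht modules -/

section Forms

variable {n : ℕ} {M M' N : Type*} [AddCommGroup M] [Module ℝ M] [Module (GroupRing n) M]
  [AddCommGroup M'] [Module ℝ M'] [Module (GroupRing n) M'] [AddCommGroup N] [Module ℝ N]

/-- Invariance of a bilinear map under the diagonal action of the symmetric group. -/
def IsInvariantForm (β : M →ₗ[ℝ] M' →ₗ[ℝ] N) : Prop :=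
  ∀ (s : Equiv.Perm (Fin n)) (u : M) (v : M'), β (perm s • u) (perm s • v) = β u v

theorem IsInvariantForm.flip {β : M →ₗ[ℝ] M' →ₗ[ℝ] N} (h : IsInvariantForm (n := n) β) :
    IsInvariantForm (n := n) β.flip := fun s u v => h s v u

theorem IsInvariantForm.perm_smul_left {β : M →ₗ[ℝ] M' →ₗ[ℝ] N}
    (h : IsInvariantForm (n := n) β) (s : Equiv.Perm (Fin n)) (u : M) (v : M') :
    β (perm s • u) v = β u (perm s⁻¹ • v) := by
  rw [← h s u, ← mul_smul, ← map_mul, mul_inv_cancel, map_one, one_smul]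

/-- `κ_T` is self-adjoint for an invariant form, as `s` and `s⁻¹` have the same sign. -/
theorem IsInvariantForm.columnAntisymmetrizer_smul [IsScalarTower ℝ (GroupRing n) M]
    [IsScalarTower ℝ (GroupRing n) M'] {β : M →ₗ[ℝ] M' →ₗ[ℝ] N}
    (h : IsInvariantForm (n := n) β) {p : n.Partition} (T : Tableau p) (u : M) (v : M') :
    β (columnAntisymmetrizer T • u) v = β u (columnAntisymmetrizer T • v) := by
  simp only [columnAntisymmetrizer, Finset.sum_smul, map_sum, LinearMap.sum_apply, smul_assoc,
    map_smul, LinearMap.smul_apply]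
  refine Finset.sum_bij (fun s _ => s⁻¹) (fun s hs => inv_mem_columnGroup hs)
    (fun a _ b _ hab => inv_injective hab)
    (fun s hs => ⟨s⁻¹, inv_mem_columnGroup hs, inv_inv s⟩) ?_
  intro s _
  rw [h.perm_smul_left, Equiv.Perm.sign_inv]

end Forms

section SpechtForms

variable {n : ℕ} {N : Type*} [AddCommGroup N] [Module ℝ N]

/-- An invariant form vanishes if it vanishes on the generators of the Specht module. -/
theorem IsInvariantForm.eq_zero_of_spechtVec {p q : n.Partition}
    {β : specht p →ₗ[ℝ] specht q →ₗ[ℝ] N} (h : IsInvariantForm (n := n) β)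
    (h0 : ∀ (T : Tableau p) (v : specht q), β (spechtVec T) v = 0) (u : specht p)
    (v : specht q) : β u v = 0 := by
  obtain ⟨u, hu⟩ := u
  induction hu using Submodule.span_induction generalizing v with
  | mem x hx =>
    obtain ⟨T, rfl⟩ := hx
    exact h0 T v
  | zero => exact LinearMap.congr_fun (map_zero β) v
  | add x y hx hy ihx ihy =>
    have := congrArg (fun f => f v) (map_add β ⟨x, hx⟩ ⟨y, hy⟩)
    exact this.trans (by rw [LinearMap.add_apply, ihx, ihy, add_zero])
  | smul a x hx ih =>
    change β (a • (⟨x, hx⟩ : specht p)) v = 0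
    induction a using MonoidAlgebra.induction_on with
    | of s => rw [h.perm_smul_left, ih]
    | add a b ha hb => rw [add_smul, map_add, LinearMap.add_apply, ha, hb, add_zero]
    | smul c a ha => rw [smul_assoc, map_smul, LinearMap.smul_apply, ha, smul_zero]

theorem IsInvariantForm.card_smul_spechtVec {p q : n.Partition}
    {β : specht p →ₗ[ℝ] specht q →ₗ[ℝ] N} (h : IsInvariantForm (n := n) β) (T : Tableau p)
    (v : specht q) :
    (#(columnGroup T) : ℝ) • β (spechtVec T) v =
      β (spechtVec T) (columnAntisymmetrizer T • v) := by
  rw [← h.columnAntisymmetrizer_smul, columnAntisymmetrizer_smul_spechtVec, map_smul,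
    LinearMap.smul_apply]

theorem card_columnGroup_ne_zero {p : n.Partition} (T : Tableau p) :
    (#(columnGroup T) : ℝ) ≠ 0 :=
  Nat.cast_ne_zero.2 (Finset.card_ne_zero_of_mem (one_mem_columnGroup T))

/-- A nonzero invariant form on `S^p × S^q` exists only if `p` dominates `q`. -/
theorem IsInvariantForm.cellsAbove_le {p q : n.Partition}
    {β : specht p →ₗ[ℝ] specht q →ₗ[ℝ] N} (h : IsInvariantForm (n := n) β) {u : specht p}
    {v : specht q} (hne : β u v ≠ 0) (m : ℕ) : cellsAbove q m ≤ cellsAbove p m := by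
  by_contra hm
  refine hne (h.eq_zero_of_spechtVec (fun T v => ?_) u v)
  refine (smul_eq_zero.1 ?_).resolve_left (card_columnGroup_ne_zero T)
  rw [h.card_smul_spechtVec,
    columnAntisymmetrizer_smul_eq_zero T (fun U hU => hm (hU.cellsAbove_le m)), map_zero]

/-- Invariant bilinear maps between Specht modules of different shapes vanish. -/
theorem IsInvariantForm.eq_zero_of_ne {p q : n.Partition}
    {β : specht p →ₗ[ℝ] specht q →ₗ[ℝ] N} (h : IsInvariantForm (n := n) β) (hpq : p ≠ q)
    (u : specht p) (v : specht q) : β u v = 0 := by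
  by_contra hne
  exact hpq (cellsAbove_injective (funext fun m =>
    le_antisymm (h.flip.cellsAbove_le hne m) (h.cellsAbove_le hne m)))

/-- The bilinear form on finitely supported functions for which the point masses are
orthonormal. -/
def finsuppInner (α : Type*) : (α →₀ ℝ) →ₗ[ℝ] (α →₀ ℝ) →ₗ[ℝ] ℝ :=
  Finsupp.lsum ℝ fun r => LinearMap.toSpanSingleton ℝ _ (Finsupp.lapply r)

theorem finsuppInner_apply {α : Type*} (x y : α →₀ ℝ) :
    finsuppInner α x y = x.sum fun r a => a * y r := by
  rw [finsuppInner, Finsupp.lsum_apply, Finsupp.sum, LinearMap.sum_apply]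
  rfl

theorem finsuppInner_self_nonneg {α : Type*} (x : α →₀ ℝ) : 0 ≤ finsuppInner α x x := by
  rw [finsuppInner_apply]
  exact Finset.sum_nonneg fun r _ => mul_self_nonneg _

theorem eq_zero_of_finsuppInner_self {α : Type*} {x : α →₀ ℝ} (h : finsuppInner α x x = 0) :
    x = 0 := by
  rw [finsuppInner_apply, Finsupp.sum,
    Finset.sum_eq_zero_iff_of_nonneg fun r _ => mul_self_nonneg _] at h
  refine Finsupp.ext fun r => ?_
  by_cases hr : r ∈ x.support
  · exact mul_self_eq_zero.1 (h r hr)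
  · exact Finsupp.notMem_support_iff.1 hr

theorem finsuppInner_comm {α : Type*} (x y : α →₀ ℝ) :
    finsuppInner α x y = finsuppInner α y x := by
  classical
  have h : finsuppInner α = (finsuppInner α).flip := by
    refine Finsupp.lhom_ext' fun r => LinearMap.ext_ring (Finsupp.lhom_ext' fun r' =>
      LinearMap.ext_ring ?_)
    change finsuppInner α (Finsupp.single r 1) (Finsupp.single r' 1) =
      finsuppInner α (Finsupp.single r' 1) (Finsupp.single r 1)
    simp [finsuppInner_apply, Finsupp.single_apply, eq_comm]
  exact LinearMap.congr_fun (LinearMap.congr_fun h x) y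

theorem finsuppInner_mapDomain {α : Type*} {f : α → α} (hf : Function.Injective f)
    (x y : α →₀ ℝ) :
    finsuppInner α (x.mapDomain f) (y.mapDomain f) = finsuppInner α x y := by
  rw [finsuppInner_apply, Finsupp.sum_mapDomain_index_inj hf, finsuppInner_apply]
  simp only [Finsupp.mapDomain_apply hf]

/-- The coordinates of an element of the Specht module with respect to the row assignments. -/
def spechtCoords (p : n.Partition) : specht p →ₗ[ℝ] ((Fin n → ℕ) →₀ ℝ) :=
  ((tabloidRep n).asModuleEquiv.toLinearMap ∘ₗ (specht p).subtype.restrictScalars ℝ :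
    specht p →ₗ[ℝ] TabloidModule n)

theorem spechtCoords_injective (p : n.Partition) : Function.Injective (spechtCoords p) :=
  Subtype.val_injective

theorem spechtCoords_perm_smul {p : n.Partition} (s : Equiv.Perm (Fin n)) (u : specht p) :
    spechtCoords p (perm s • u) =
      (spechtCoords p u).mapDomain fun r : Fin n → ℕ => r ∘ ⇑s⁻¹ := by
  have h : (tabloidRep n).asModuleEquiv (perm s • (u : (tabloidRep n).asModule)) =
      tabloidRep n s ((tabloidRep n).asModuleEquiv u) := by
    rw [Representation.asModuleEquiv_map_smul, Representation.asAlgebraHom_of]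
  exact h

/-- The standard inner product, for which the tabloids are orthonormal, restricted to a Specht
module. -/
def spechtInner (p : n.Partition) : specht p →ₗ[ℝ] specht p →ₗ[ℝ] ℝ :=
  (finsuppInner (Fin n → ℕ)).compl₁₂ (spechtCoords p) (spechtCoords p)

theorem spechtInner_invariant (p : n.Partition) : IsInvariantForm (n := n) (spechtInner p) := by
  intro s u v
  simp only [spechtInner, LinearMap.compl₁₂_apply, spechtCoords_perm_smul]
  exact finsuppInner_mapDomain (s⁻¹).surjective.injective_comp_right _ _

theorem spechtInner_self_nonneg {p : n.Partition} (u : specht p) : 0 ≤ spechtInner p u u :=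
  finsuppInner_self_nonneg _

theorem spechtInner_comm {p : n.Partition} (u v : specht p) :
    spechtInner p u v = spechtInner p v u :=
  finsuppInner_comm _ _

theorem eq_zero_of_spechtInner_self {p : n.Partition} {u : specht p}
    (h : spechtInner p u u = 0) : u = 0 :=
  spechtCoords_injective p ((eq_zero_of_finsuppInner_self h).trans (map_zero _).symm)

/-- Schur's lemma for forms: an invariant bilinear map on a Specht module is the standard inner
product times a constant vector. -/
theorem IsInvariantForm.exists_eq_spechtInner_smul {p : n.Partition}
    {β : specht p →ₗ[ℝ] specht p →ₗ[ℝ] N} (h : IsInvariantForm (n := n) β) (T₀ : Tableau p) :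
    ∃ c : N, ∀ u v, β u v = spechtInner p u v • c := by
  -- All tableaux are permuted transitively, so `⟨e_T, e_T⟩` and `β(e_T, e_T)` do not depend on `T`.
  have const : ∀ {N : Type _} [AddCommGroup N] [Module ℝ N]
      {γ : specht p →ₗ[ℝ] specht p →ₗ[ℝ] N}, IsInvariantForm (n := n) γ → ∀ T : Tableau p,
      γ (spechtVec T) (spechtVec T) = γ (spechtVec T₀) (spechtVec T₀) := by
    intro N _ _ γ hγ T
    have hT : T₀.trans (T₀.symm.trans T) = T := by ext; simp
    have := hγ (T₀.symm.trans T) (spechtVec T₀) (spechtVec T₀)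
    rwa [perm_smul_spechtVec, hT] at this
  let c : N := (spechtInner p (spechtVec T₀) (spechtVec T₀))⁻¹ • β (spechtVec T₀) (spechtVec T₀)
  let γ : specht p →ₗ[ℝ] specht p →ₗ[ℝ] N :=
    β - (spechtInner p).compr₂ (LinearMap.toSpanSingleton ℝ N c)
  have hγ : IsInvariantForm (n := n) γ := fun s u v => by
    simp only [γ, LinearMap.sub_apply, LinearMap.compr₂_apply, h s u v,
      spechtInner_invariant p s u v]
  refine ⟨c, fun u v => sub_eq_zero.1 (hγ.eq_zero_of_spechtVec (fun T v => ?_) u v)⟩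
  refine (smul_eq_zero.1 ?_).resolve_left (card_columnGroup_ne_zero T)
  obtain ⟨a, ha⟩ := exists_columnAntisymmetrizer_smul_eq T v
  rw [hγ.card_smul_spechtVec, ha, map_smul]
  have hself : γ (spechtVec T) (spechtVec T) = 0 := by
    rw [const hγ]
    change β _ _ - spechtInner p _ _ • c = 0
    -- If `⟨e_T, e_T⟩ = 0`, the division in `c` is by zero, but then `e_T = 0`.
    by_cases h0 : spechtInner p (spechtVec T₀) (spechtVec T₀) = 0
    · rw [eq_zero_of_spechtInner_self h0]
      simp
    · rw [smul_inv_smul₀ h0, sub_self]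
  rw [hself, smul_zero]

end SpechtForms

/-! ### The symmetrized product as an invariant form -/

/-- The symmetrized product `(f, g) ↦ sym(f g)` on polynomials of degree at most `d`. -/
def symForm (n d : ℕ) : V n d →ₗ[ℝ] V n d →ₗ[ℝ] Poly n :=
  ((LinearMap.mul ℝ (Poly n)).compl₁₂ (V n d).subtype (V n d).subtype).compr₂
    (((n.factorial : ℝ)⁻¹) • ∑ s : Equiv.Perm (Fin n), (act s).toLinearMap)

theorem symForm_apply {n d : ℕ} (f g : V n d) :
    symForm n d f g = sym ((f : Poly n) * (g : Poly n)) := by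
  simp [symForm, sym]

theorem symForm_self {n d : ℕ} (f : V n d) : symForm n d f f = sym ((f : Poly n) ^ 2) := by
  rw [symForm_apply, sq]

theorem sym_act {n : ℕ} (s : Equiv.Perm (Fin n)) (f : Poly n) : sym (act s f) = sym f := by
  rw [sym, sym]
  congr 1
  simp only [← act_mul]
  exact Fintype.sum_equiv (Equiv.mulRight s) _ _ fun _ => rfl

theorem symForm_polyRep {n d : ℕ} (s : Equiv.Perm (Fin n)) (f g : V n d) :
    symForm n d (polyRep n d s f) (polyRep n d s g) = symForm n d f g := by
  rw [symForm_apply, symForm_apply, ← sym_act s ((f : Poly n) * g), map_mul]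
  rfl

/-- A real polynomial vanishes if its square symmetrizes to zero, because a sum of squares of real
numbers vanishes only if every summand does. -/
theorem eq_zero_of_symForm_self {n d : ℕ} {f : V n d} (h : symForm n d f f = 0) : f = 0 := by
  rw [symForm_self, sym] at h
  have hsum := (smul_eq_zero.1 h).resolve_left
    (inv_ne_zero (Nat.cast_ne_zero.2 n.factorial_ne_zero))
  apply Subtype.ext
  refine MvPolynomial.funext fun x => ?_
  have hx := congrArg (MvPolynomial.eval x) hsum
  simp only [map_pow, map_sum, map_zero] at hx
  have h1 := (Finset.sum_eq_zero_iff_of_nonneg fun s _ => sq_nonneg _).1 hx 1 (mem_univ _)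
  rw [act_one] at h1
  simpa using h1

/-! ### Orthogonality of the isotypic components -/

/-- `φ` commutes with the action of the symmetric group. -/
def IsEquivariant {n d : ℕ} {p : n.Partition} (φ : specht p →ₗ[ℝ] V n d) : Prop :=
  ∀ (s : Equiv.Perm (Fin n)) (u : specht p), φ (perm s • u) = polyRep n d s (φ u)

theorem IsEquivariant.isInvariantForm {n d : ℕ} {p q : n.Partition} {φ : specht p →ₗ[ℝ] V n d}
    {ψ : specht q →ₗ[ℝ] V n d} (hφ : IsEquivariant φ) (hψ : IsEquivariant ψ) :
    IsInvariantForm (n := n) ((symForm n d).compl₁₂ φ ψ) := fun s u v => by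
  rw [LinearMap.compl₁₂_apply, hφ, hψ, symForm_polyRep, LinearMap.compl₁₂_apply]

/-- A homomorphism of modules over the group ring into the module of polynomials, as a real linear
map. -/
def toLinear {n d : ℕ} {p : n.Partition} (φ : specht p →ₗ[GroupRing n] (polyRep n d).asModule) :
    specht p →ₗ[ℝ] V n d :=
  (polyRep n d).asModuleEquiv.toLinearMap ∘ₗ φ.restrictScalars ℝ

theorem toLinear_isEquivariant {n d : ℕ} {p : n.Partition}
    (φ : specht p →ₗ[GroupRing n] (polyRep n d).asModule) : IsEquivariant (toLinear φ) := by
  intro s u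
  have h : (polyRep n d).asModuleEquiv (perm s • φ u) =
      polyRep n d s ((polyRep n d).asModuleEquiv (φ u)) := by
    rw [Representation.asModuleEquiv_map_smul, Representation.asAlgebraHom_of]
  exact (congrArg (polyRep n d).asModuleEquiv (map_smul φ (perm s) u)).trans h

/-- The isotypic component is spanned by the images of the equivariant maps from the Specht
module. -/
theorem isotypic_le {n d : ℕ} {p : n.Partition} {K : Submodule ℝ (V n d)}
    (h : ∀ φ : specht p →ₗ[ℝ] V n d, IsEquivariant φ → ∀ u, φ u ∈ K) : isotypic n d p ≤ K := by
  rintro _ ⟨x, hx, rfl⟩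
  change (polyRep n d).asModuleEquiv x ∈ K
  change x ∈ isotypicComponent _ _ _ at hx
  rw [isotypicComponent, sSup_eq_iSup'] at hx
  induction hx using Submodule.iSup_induction' with
  | mem m x hx =>
    obtain ⟨e⟩ := m.2
    have := h _ (toLinear_isEquivariant (m.1.subtype ∘ₗ e.symm.toLinearMap)) (e ⟨x, hx⟩)
    simpa [toLinear] using this
  | zero => rw [map_zero]; exact zero_mem _
  | add x y _ _ hx hy => rw [map_add]; exact add_mem hx hy

theorem symForm_eq_zero_of_isotypic {n d : ℕ} {p q : n.Partition} (hpq : p ≠ q) {f g : V n d}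
    (hf : f ∈ isotypic n d p) (hg : g ∈ isotypic n d q) : symForm n d f g = 0 := by
  have h1 : isotypic n d p ≤ LinearMap.ker ((symForm n d).flip g) := by
    refine isotypic_le fun φ hφ u => ?_
    have h2 : isotypic n d q ≤ LinearMap.ker (symForm n d (φ u)) :=
      isotypic_le fun ψ hψ v => (hφ.isInvariantForm hψ).eq_zero_of_ne hpq u v
    exact h2 hg
  exact h1 hf

theorem symForm_eq_zero_of_iSup_isotypic {n d : ℕ} {Λ : Finset n.Partition} {q : n.Partition}
    (hq : q ∉ Λ) {f g : V n d} (hf : f ∈ ⨆ p ∈ Λ, isotypic n d p) (hg : g ∈ isotypic n d q) :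
    symForm n d f g = 0 := by
  have h : ⨆ p ∈ Λ, isotypic n d p ≤ LinearMap.ker ((symForm n d).flip g) :=
    iSup₂_le fun p hp x hx => by
      rw [LinearMap.mem_ker, LinearMap.flip_apply]
      exact symForm_eq_zero_of_isotypic (ne_of_mem_of_not_mem hp hq) hx hg
  exact h hf

theorem symForm_sum_self {n d : ℕ} {Λ : Finset n.Partition} {g : n.Partition → V n d}
    (hg : ∀ p ∈ Λ, g p ∈ isotypic n d p) :
    symForm n d (∑ p ∈ Λ, g p) (∑ p ∈ Λ, g p) = ∑ p ∈ Λ, symForm n d (g p) (g p) := by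
  rw [map_sum]
  refine Finset.sum_congr rfl fun p hp => ?_
  rw [map_sum, LinearMap.sum_apply]
  exact Finset.sum_eq_single_of_mem p hp fun q hq hqp =>
    symForm_eq_zero_of_isotypic hqp (hg q hq) (hg p hp)

/-! ### Symmetry-adapted bases -/

theorem posSemidef_spechtInner {n : ℕ} {p : n.Partition} {κ : Type*} [Fintype κ]
    (a : κ → specht p) : (Matrix.of fun i j => spechtInner p (a i) (a j)).PosSemidef := by
  refine Matrix.PosSemidef.of_dotProduct_mulVec_nonneg ?_ fun x => ?_
  · ext i j
    simp [Matrix.conjTranspose_apply, spechtInner_comm (a j)]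
  · have hx : dotProduct (star x) ((Matrix.of fun i j => spechtInner p (a i) (a j)).mulVec x) =
        spechtInner p (∑ i, x i • a i) (∑ i, x i • a i) := by
      simp only [Matrix.mulVec, dotProduct, Matrix.of_apply, map_sum, map_smul,
        LinearMap.sum_apply, LinearMap.smul_apply, smul_eq_mul, Pi.star_apply, star_trivial,
        Finset.mul_sum]
      rw [Finset.sum_comm]
      exact Finset.sum_congr rfl fun j _ => Finset.sum_congr rfl fun i _ => by ring
    rw [hx]
    exact spechtInner_self_nonneg _

namespace SymmetryAdaptedBasis

variable {n d : ℕ} (B : SymmetryAdaptedBasis n d)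

theorem basis_mem_isotypic (p : n.Partition) (i : Fin (B.mult p)) (t : StandardTableau p) :
    B.basis ⟨p, i, t⟩ ∈ isotypic n d p := by
  refine ⟨(polyRep n d).asModuleEquiv.symm (B.basis ⟨p, i, t⟩), ?_, by simp⟩
  change _ ∈ isotypicComponent (GroupRing n) (polyRep n d).asModule (specht p)
  have hle := le_sSup (s := {m : Submodule (GroupRing n) (polyRep n d).asModule |
    Nonempty (m ≃ₗ[GroupRing n] specht p)}) (B.iso_specht p i)
  exact hle (Submodule.subset_span ⟨t, rfl⟩)

/-- The component of `f` in the summands `V_p^1, …, V_p^{m_p}`. -/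
def component (p : n.Partition) (f : V n d) : V n d :=
  ∑ i, ∑ t, B.basis.repr f ⟨p, i, t⟩ • B.basis ⟨p, i, t⟩

theorem component_mem_isotypic (p : n.Partition) (f : V n d) :
    B.component p f ∈ isotypic n d p :=
  Submodule.sum_mem _ fun i _ => Submodule.sum_mem _ fun t _ =>
    Submodule.smul_mem _ _ (B.basis_mem_isotypic p i t)

theorem sum_component (f : V n d) : ∑ p, B.component p f = f := by
  conv_rhs => rw [← B.basis.sum_repr f]
  simp only [component, Fintype.sum_sigma, Fintype.sum_prod_type]

/-- Components outside `Λ` vanish: such a component is orthogonal to `f`, hence to itself. -/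
theorem component_eq_zero {Λ : Finset n.Partition} {f : V n d}
    (hf : f ∈ ⨆ p ∈ Λ, isotypic n d p) {q : n.Partition} (hq : q ∉ Λ) :
    B.component q f = 0 := by
  apply eq_zero_of_symForm_self
  have h := symForm_eq_zero_of_iSup_isotypic hq hf (B.component_mem_isotypic q f)
  generalize hg : B.component q f = g at h ⊢
  rwa [← B.sum_component f, map_sum, LinearMap.sum_apply,
    Finset.sum_eq_single_of_mem q (mem_univ q) fun p _ hpq => symForm_eq_zero_of_isotypic hpq
      (B.component_mem_isotypic p f) (hg ▸ B.component_mem_isotypic q f), hg] at h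

theorem sum_component_of_mem {Λ : Finset n.Partition} {f : V n d}
    (hf : f ∈ ⨆ p ∈ Λ, isotypic n d p) : ∑ p ∈ Λ, B.component p f = f := by
  conv_rhs => rw [← B.sum_component f]
  exact Finset.sum_subset (subset_univ Λ) fun q _ hq => B.component_eq_zero hf hq

/-- The linear map sending `y_{p,i,t}` to `y_{p,j,t}` and all other basis vectors to zero. -/
def transfer {p : n.Partition} (i j : Fin (B.mult p)) : V n d →ₗ[ℝ] V n d :=
  ∑ t, (B.basis.coord ⟨p, i, t⟩).smulRight (B.basis ⟨p, j, t⟩)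

theorem transfer_apply {p : n.Partition} (i j : Fin (B.mult p)) (f : V n d) :
    B.transfer i j f = ∑ t, B.basis.repr f ⟨p, i, t⟩ • B.basis ⟨p, j, t⟩ := by
  simp [transfer]

theorem transfer_basis {p : n.Partition} (i j : Fin (B.mult p)) (t : StandardTableau p) :
    B.transfer i j (B.basis ⟨p, i, t⟩) = B.basis ⟨p, j, t⟩ := by
  rw [transfer_apply, Finset.sum_eq_single_of_mem t (mem_univ t)]
  · simp
  · intro t' _ ht'
    rw [B.basis.repr_self, Finsupp.single_eq_of_ne, zero_smul]
    intro h
    simp_all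

theorem transfer_basis_of_ne {p q : n.Partition} (i j : Fin (B.mult p)) (k : Fin (B.mult q))
    (h : ¬ ∃ hqp : q = p, hqp ▸ k = i) (t : StandardTableau q) :
    B.transfer i j (B.basis ⟨q, k, t⟩) = 0 := by
  rw [transfer_apply]
  refine Finset.sum_eq_zero fun t' _ => ?_
  rw [B.basis.repr_self, Finsupp.single_eq_of_ne, zero_smul]
  intro h'
  simp only [Sigma.mk.injEq] at h'
  obtain ⟨rfl, h'⟩ := h'
  simp_all

/-- `transfer` is equivariant because all `V_p^i` share their representing matrices. -/
theorem transfer_polyRep {p : n.Partition} (i j : Fin (B.mult p)) (s : Equiv.Perm (Fin n))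
    (f : V n d) : B.transfer i j (polyRep n d s f) = polyRep n d s (B.transfer i j f) := by
  suffices h : B.transfer i j ∘ₗ polyRep n d s = polyRep n d s ∘ₗ B.transfer i j from
    LinearMap.congr_fun h f
  refine B.basis.ext ?_
  rintro ⟨q, k, t⟩
  rw [LinearMap.comp_apply, LinearMap.comp_apply, B.polyRep_basis, map_sum]
  simp only [map_smul]
  by_cases h : ∃ hqp : q = p, hqp ▸ k = i
  · obtain ⟨rfl, rfl⟩ := h
    simp only [transfer_basis, B.polyRep_basis]
  · simp only [B.transfer_basis_of_ne i j k h, smul_zero, Finset.sum_const_zero, map_zero]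

/-- The bases of all `V_p^i` are images of one and the same family in the Specht module. -/
theorem exists_equivariant {p : n.Partition} (i₀ : Fin (B.mult p)) :
    ∃ (ε : StandardTableau p → specht p) (φ : Fin (B.mult p) → specht p →ₗ[ℝ] V n d),
      (∀ i, IsEquivariant (φ i)) ∧ ∀ i t, φ i (ε t) = B.basis ⟨p, i, t⟩ := by
  obtain ⟨e⟩ := B.iso_specht p i₀
  let ψ := toLinear (d := d) (Submodule.subtype _ ∘ₗ e.symm.toLinearMap)
  refine ⟨fun t => e ⟨(polyRep n d).asModuleEquiv.symm (B.basis ⟨p, i₀, t⟩),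
    Submodule.subset_span ⟨t, rfl⟩⟩, fun i => B.transfer i₀ i ∘ₗ ψ, ?_, ?_⟩
  · intro i s u
    rw [LinearMap.comp_apply, toLinear_isEquivariant _ s u, transfer_polyRep]
    rfl
  · intro i t
    rw [← B.transfer_basis i₀ i t]
    simp [ψ, toLinear]

/-- Symmetrized sums of squares of elements of `⨁_i V_p^i` are of the form `⟨Q, Y_p⟩` with `Q`
positive semidefinite: `Q` is a multiple of a sum of Gram matrices in the Specht module. -/
theorem exists_posSemidef {ι : Type*} [Fintype ι] (p : n.Partition) (t : StandardTableau p)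
    (f : ι → V n d) :
    ∃ Q : Matrix (Fin (B.mult p)) (Fin (B.mult p)) ℝ, Q.PosSemidef ∧
      ∑ l, symForm n d (B.component p (f l)) (B.component p (f l)) =
        ∑ i, ∑ j, Q i j • B.Y p t i j := by
  rcases isEmpty_or_nonempty (Fin (B.mult p)) with hempty | ⟨⟨i₀⟩⟩
  · exact ⟨0, Matrix.PosSemidef.zero, by simp [component]⟩
  obtain ⟨ε, φ, hφ, hε⟩ := B.exists_equivariant i₀
  choose c hc using fun i j =>
    ((hφ i).isInvariantForm (hφ j)).exists_eq_spechtInner_smul t.1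
  simp only [LinearMap.compl₁₂_apply] at hc
  have hY : ∀ i j, B.Y p t i j = spechtInner p (ε t) (ε t) • c i j := fun i j => by
    rw [← hc, hε, hε, symForm_apply]
    rfl
  have hpos : spechtInner p (ε t) (ε t) ≠ 0 := fun h0 => by
    apply B.basis.ne_zero ⟨p, i₀, t⟩
    rw [← hε, eq_zero_of_spechtInner_self h0, map_zero]
  let a : ι → Fin (B.mult p) → specht p := fun l i =>
    ∑ t, B.basis.repr (f l) ⟨p, i, t⟩ • ε t
  have hcomp : ∀ l, B.component p (f l) = ∑ i, φ i (a l i) := fun l => by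
    simp only [component, a, map_sum, map_smul, hε]
  refine ⟨(spechtInner p (ε t) (ε t))⁻¹ •
    ∑ l, Matrix.of fun i j => spechtInner p (a l i) (a l j), ?_, ?_⟩
  · exact (Matrix.posSemidef_sum _ fun l _ => posSemidef_spechtInner (a l)).smul
      (inv_nonneg.2 (spechtInner_self_nonneg _))
  · have hQ : ∀ i j, ((spechtInner p (ε t) (ε t))⁻¹ •
        ∑ l, Matrix.of fun i j => spechtInner p (a l i) (a l j)) i j • B.Y p t i j =
        ∑ l, spechtInner p (a l i) (a l j) • c i j := fun i j => by
      rw [hY, smul_smul, Matrix.smul_apply, smul_eq_mul, mul_right_comm, inv_mul_cancel₀ hpos,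
        one_mul, Matrix.sum_apply, Finset.sum_smul]
      rfl
    simp only [hQ, hcomp, map_sum, LinearMap.sum_apply, hc]
    rw [Finset.sum_comm]
    conv_rhs => rw [Finset.sum_comm]
    refine Finset.sum_congr rfl fun j _ => ?_
    exact Finset.sum_comm

end SymmetryAdaptedBasis

/-! ### Symmetrization modulo an ideal -/

/-- A polynomial invariant modulo an ideal agrees with its symmetrization modulo that ideal. -/
theorem sub_sym_mem {n : ℕ} {I : Ideal (Poly n)} {F : Poly n}
    (h : ∀ s : Equiv.Perm (Fin n), act s F - F ∈ I) : F - sym F ∈ I := by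
  have hn : (n.factorial : ℝ) ≠ 0 := Nat.cast_ne_zero.2 n.factorial_ne_zero
  have key : F - sym F =
      -(MvPolynomial.C ((n.factorial : ℝ)⁻¹) * ∑ s : Equiv.Perm (Fin n), (act s F - F)) := by
    rw [Finset.sum_sub_distrib, Finset.sum_const, Finset.card_univ, Fintype.card_perm,
      Fintype.card_fin, mul_sub, ← MvPolynomial.smul_eq_C_mul, ← MvPolynomial.smul_eq_C_mul,
      ← Nat.cast_smul_eq_nsmul ℝ, inv_smul_smul₀ hn, neg_sub]
    rfl
  rw [key]
  exact I.neg_mem (I.mul_mem_left _ (I.sum_mem fun s _ => h s))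

theorem sym_sum {n : ℕ} {ι : Type*} [Fintype ι] (f : ι → Poly n) :
    sym (∑ l, f l) = ∑ l, sym (f l) := by
  simp only [sym, map_sum, ← Finset.smul_sum]
  rw [Finset.sum_comm]

end SymSOS

end

theorem proposition4p10 (n d : ℕ) {ι : Type*} [Fintype ι] (Λ : Finset n.Partition)
    (f : ι → SymSOS.V n d)
    (hf : ∀ l, f l ∈ ⨆ p ∈ Λ, SymSOS.isotypic n d p) :
    -- the cross terms vanish after symmetrization
    (∀ g : ι → n.Partition → SymSOS.V n d,
      (∀ l, ∀ p ∈ Λ, g l p ∈ SymSOS.isotypic n d p) →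
      (∀ l, f l = ∑ p ∈ Λ, g l p) →
      ∀ l,
        (∀ p ∈ Λ, ∀ q ∈ Λ, p ≠ q →
          SymSOS.sym ((g l p : SymSOS.Poly n) * (g l q : SymSOS.Poly n)) = 0) ∧
        SymSOS.sym ((f l : SymSOS.Poly n) ^ 2) =
          ∑ p ∈ Λ, SymSOS.sym ((g l p : SymSOS.Poly n) ^ 2)) ∧
    -- an invariant sum of squares (modulo any ideal `I`, in particular `I = ⊥`) is obtained
    -- from the restricted program
    (∀ I : Ideal (SymSOS.Poly n),
      (∀ s : Equiv.Perm (Fin n),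
        SymSOS.act s (∑ l, (f l : SymSOS.Poly n) ^ 2) - ∑ l, (f l : SymSOS.Poly n) ^ 2 ∈ I) →
      ∀ (B : SymSOS.SymmetryAdaptedBasis n d)
        (t : ∀ p : n.Partition, SymSOS.StandardTableau p),
        SymSOS.ObtainableThroughGP B t I Λ (∑ l, (f l : SymSOS.Poly n) ^ 2)) := by
  refine ⟨fun g hg hsum l => ⟨fun p hp q hq hpq => ?_, ?_⟩, fun I hI B t => ?_⟩
  · rw [← SymSOS.symForm_apply]
    exact SymSOS.symForm_eq_zero_of_isotypic hpq (hg l p hp) (hg l q hq)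
  · simp only [← SymSOS.symForm_self]
    rw [hsum l, SymSOS.symForm_sum_self (hg l)]
  · choose Q hQ hQsum using fun p => B.exists_posSemidef p (t p) f
    refine ⟨Q, fun p _ => hQ p, ?_⟩
    convert SymSOS.sub_sym_mem hI using 2
    rw [SymSOS.sym_sum, ← Finset.sum_congr rfl fun p _ => hQsum p, Finset.sum_comm]
    refine Finset.sum_congr rfl fun l _ => ?_
    rw [← SymSOS.symForm_self, ← SymSOS.symForm_sum_self fun p _ =>
      B.component_mem_isotypic p (f l), B.sum_component_of_mem (hf l)]
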